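/- Let $\tau:L\to M$ be a smooth real vector bundle of finite rank over a smooth manifold $M$, with a Lie algebroid structure (bracket $[\cdot,\cdot]$ on $\Gamma(L)$, anchor $a$), and let $\Phi\in\Gamma(L^*)$ be a $1$-cocycle, $d\Phi=0$, for the exterior derivative $d$ of the Lie algebroid. For $f\in C^\infty(M)$, $\mu\in\Gamma(L^*)$, $Y\in\Gamma(L)$ put $$d^\Phi f=df+f\Phi,\qquad d^\Phi\mu=d\mu+\Phi\wedge\mu,\qquad \pounds_Y\mu=i_Yd\mu+d(i_Y\mu),\qquad \pounds^\Phi_Y\mu=i_Yd^\Phi\mu+d^\Phi(i_Y\mu).$$ For $\mu\in\Gamma(L^*)$ let $\iota_\mu$ be the fibrewise linear function $\iota_\mu(v)=\langle\mu(\tau(v)),v\rangle$ on the total space of $L$. Let $X\mapsto X^v$ be the vertical lift of sections of $\bigwedge^\bullet L$ to multivector fields on the total space of $L$ (with $f^v=f\circ\tau$ for functions), let $\nabla$ be the Liouville (Euler) vector field of $L$, and let $X\mapsto X^c$ be the complete lift: the unique additive local lift of sections of $\bigwedge^\bullet L$ to fibrewise homogeneous multivector fields on the total space of $L$ with $f^c=\iota_{df}$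 for functions $f$, $Y^c(\iota_\mu)=\iota_{\pounds_Y\mu}$ for $Y\in\Gamma(L)$, $\mu\in\Gamma(L^*)$, and $(X\wedge Z)^c=X^c\wedge Z^v+X^v\wedge Z^c$. Pairings are normalized by $\langle Y_0\wedge\dots\wedge Y_x,\mu_0\wedge\dots\wedge\mu_x\rangle=\det\langle Y_i,\mu_j\rangle$, and contractions by $\langle i_\omega X,\nu\rangle=\langle X,\omega\wedge\nu\rangle$. For $X\in\mathcal A^x(L)=\Gamma(\bigwedge^{x+1}L)$ the Poisson lift is $$X^c_\Phi=X^c-x\,\iota_\Phi X^v+\nabla\wedge(i_\Phi X)^v$$ (with $i_\Phi X=0$ if $x=-1$), and the bracket $[\mu_0,\dots,\mu_x]_{X^c_\Phi}\in\Gamma(L^*)$ of $\mu_0,\dots,\mu_x\in\Gamma(L^*)$ induced by $X^c_\Phi$ is defined by $$\iota_{[\mu_0,\dots,\mu_x]_{X^c_\Phi}}=\langle X^c_\Phi,\ d\iota_{\mu_0}\wedge\dots\wedge d\iota_{\mu_x}\rangle .$$ Theorem. Let $x\ge 0$ and $X\in\mathcal A^x(L)$. For all $\mu_0,\dots,\mu_x\in\Gamma(L^*)$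 the bracket $[\mu_0,\dots,\mu_x]_{X^c_\Phi}$ exists and $$[\mu_0,\dots,\mu_x]_{X^c_\Phi}=\sum_{k=0}^x(-1)^{x+k}\pounds^\Phi_{X_k}\mu_k-x\,d^\Phi\langle X,\mu_0\wedge\dots\wedge\mu_x\rangle,\qquad X_k=i_{\mu_0\wedge\dots\check\mu_k\dots\wedge\mu_x}X,$$ where $\check\mu_k$ means that $\mu_k$ is omitted. In particular, for all $f_0,\dots,f_x\in C^\infty(M)$, $$[d^\Phi f_0,\dots,d^\Phi f_x]_{X^c_\Phi}=d^\Phi\langle X,d^\Phi f_0\wedge\dots\wedge d^\Phi f_x\rangle .$$ For $x=-1$, that is, for a function $X\in C^\infty(M)$, the bracket (of no arguments) is $d^\Phi X$. -/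

import Mathlib

open Bundle Module
open scoped Manifold ContDiff Topology

noncomputable section

set_option linter.unusedSectionVars false

namespace JacobiAlgebroid

section Sections

variable {E : Type*} [NormedAddCommGroup E] [NormedSpace ℝ E]
  {H : Type*} [TopologicalSpace H] {I : ModelWithCorners ℝ E H}
  {M : Type*} [TopologicalSpace M] [ChartedSpace H M]
  {F : Type*} [NormedAddCommGroup F] [NormedSpace ℝ F]
  {V : M → Type*} [TopologicalSpace (TotalSpace F V)]
  [∀ p, AddCommGroup (V p)] [∀ p, Module ℝ (V p)] [∀ p, TopologicalSpace (V p)]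
  [FiberBundle F V] [VectorBundle ℝ F V]

/-- Pointwise multiplication of a smooth section by a smooth function. -/
instance instSMulSection : SMul C^∞⟮I, M; ℝ⟯ Cₛ^∞⟮I; F, V⟯ :=
  ⟨fun f s => ⟨fun p => f p • s p, f.contMDiff.smul_section s.contMDiff⟩⟩

@[simp]
theorem smul_section_apply (f : C^∞⟮I, M; ℝ⟯) (s : Cₛ^∞⟮I; F, V⟯) (p : M) :
    (f • s) p = f p • s p := rfl

/-- The smooth sections of a vector bundle form a module over the smooth functions. -/
instance instModuleSection : Module C^∞⟮I, M; ℝ⟯ Cₛ^∞⟮I; F, V⟯ where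
  one_smul s := by ext p; simp
  mul_smul f g s := by ext p; simp [mul_smul]
  smul_zero f := by ext p; simp
  smul_add f s t := by ext p; simp
  add_smul f g s := by ext p; simp [add_smul]
  zero_smul s := by ext p; simp

end Sections

variable {E : Type*} [NormedAddCommGroup E] [NormedSpace ℝ E] [FiniteDimensional ℝ E]
  {H : Type*} [TopologicalSpace H] {I : ModelWithCorners ℝ E H}
  {M : Type*} [TopologicalSpace M] [ChartedSpace H M] [IsManifold I ∞ M] [T2Space M]
  {F : Type*} [NormedAddCommGroup F] [NormedSpace ℝ F] [FiniteDimensional ℝ F]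
  {L : M → Type*} [TopologicalSpace (TotalSpace F L)]
  [∀ p, AddCommGroup (L p)] [∀ p, Module ℝ (L p)] [∀ p, TopologicalSpace (L p)]
  [∀ p, IsTopologicalAddGroup (L p)] [∀ p, ContinuousSMul ℝ (L p)]
  [FiberBundle F L] [VectorBundle ℝ F L] [ContMDiffVectorBundle ∞ F L I]

variable (L) in
/-- The fibre at `p` of the dual bundle `L*`. -/
abbrev Dual : M → Type _ := fun p => L p →L[ℝ] Bundle.Trivial M ℝ p

variable (I F L) in
/-- The smooth sections of the dual bundle `L*`, that is, the `1`-forms of `L`. -/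
abbrev DualSection : Type _ := Cₛ^∞⟮I; F →L[ℝ] ℝ, Dual L⟯

/-- The function `⟨μ, s⟩`. -/
def pair (μ : DualSection I F L) (s : Cₛ^∞⟮I; F, L⟯) : C^∞⟮I, M; ℝ⟯ :=
  ⟨fun p => μ p (s p), fun p => by
    have h := (μ.contMDiff p).clm_bundle_apply (s.contMDiff p)
    exact ((contMDiffAt_totalSpace (F := ℝ) (E := Bundle.Trivial M ℝ)).1 h).2⟩

/-- A smooth local section extends, after shrinking, to a global one. -/
theorem exists_section_eventuallyEq (σ : ∀ q, L q) {u : Set M} (hu : IsOpen u) {p : M} (hp : p ∈ u)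
    (hσ : ContMDiffOn I (I.prod 𝓘(ℝ, F)) ∞ (fun q => TotalSpace.mk' F q (σ q)) u) :
    ∃ s : Cₛ^∞⟮I; F, L⟯, ∀ᶠ q in 𝓝 p, s q = σ q := by
  obtain ⟨χ, -, hχ⟩ := (SmoothBumpFunction.nhds_basis_tsupport (I := I) p).mem_iff.1 (hu.mem_nhds hp)
  have h := ContMDiffOn.smul_section_of_tsupport (n := ∞) (ψ := χ) (s := σ) χ.contMDiff.contMDiffOn
    hu hχ hσ
  refine ⟨⟨_, h⟩, ?_⟩
  filter_upwards [χ.eventuallyEq_one] with q hq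
  show χ q • σ q = σ q
  rw [hq]; simp

theorem contMDiffAt_dual {φ : ∀ p, Dual L p} {p : M} 
    (h : ∀ y : F, ContMDiffAt I 𝓘(ℝ) ∞
      (fun q => (φ q ((trivializationAt F L p).symmL ℝ q y) : ℝ)) p) :
    ContMDiffAt I (I.prod 𝓘(ℝ, F →L[ℝ] ℝ)) ∞ (fun q => TotalSpace.mk' (F →L[ℝ] ℝ) q (φ q)) p := by
  rw [contMDiffAt_hom_bundle]
  refine ⟨contMDiffAt_id, ?_⟩
  let b := finBasis ℝ F
  have h2 : ContMDiffAt I 𝓘(ℝ, F →L[ℝ] ℝ) ∞ (fun q => ∑ i,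
      (φ q ((trivializationAt F L p).symmL ℝ q (b i)) : ℝ) • (b.coord i).toContinuousLinearMap) p :=
    ContMDiffAt.sum fun i _ => (h (b i)).smul contMDiffAt_const
  refine h2.congr_of_eventuallyEq (Filter.Eventually.of_forall fun q => ?_)
  ext y
  have hy : y = ∑ i, b.coord i y • b i := by simp
  conv_lhs => rw [hy]
  simp only [ContinuousLinearMap.inCoordinates, map_sum, map_smul]
  simp [mul_comm]

/-- A family of linear forms whose values on smooth sections are smooth is a smooth section. -/
theorem contMDiff_dual {φ : ∀ p, Dual L p} (h : ∀ s : Cₛ^∞⟮I; F, L⟯,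
      ContMDiff I 𝓘(ℝ) ∞ (fun q => (φ q (s q) : ℝ))) :
    ContMDiff I (I.prod 𝓘(ℝ, F →L[ℝ] ℝ)) ∞ (fun q => TotalSpace.mk' (F →L[ℝ] ℝ) q (φ q)) := by
  intro p
  refine contMDiffAt_dual fun y => ?_
  let t := trivializationAt F L p
  have hp := mem_baseSet_trivializationAt F L p
  obtain ⟨s, hs⟩ := exists_section_eventuallyEq (I := I) (fun q => t.symmL ℝ q y) t.open_baseSet hp
    (by
      have := (t.contMDiffOn_symmL (IB := I) (n := ∞))
      rw [t.contMDiffOn_section_baseSet_iff]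
      refine (contMDiffOn_const (c := y)).congr fun q hq => ?_
      simp [hq, t])
  refine (h s p).congr_of_eventuallyEq ?_
  filter_upwards [hs] with q hq
  rw [hq]


theorem contMDiffOn_symmL_apply (p : M) (y : F) :
    ContMDiffOn I (I.prod 𝓘(ℝ, F)) ∞
      (fun q => TotalSpace.mk' F q ((trivializationAt F L p).symmL ℝ q y))
      (trivializationAt F L p).baseSet := by
  rw [(trivializationAt F L p).contMDiffOn_section_baseSet_iff]
  refine (contMDiffOn_const (c := y)).congr fun q hq => ?_
  simp [hq]

/-- Near every point there are a frame of `L` and its dual frame, formed by global sections. -/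
theorem exists_frame (I : ModelWithCorners ℝ E H) [IsManifold I ∞ M]
    [ContMDiffVectorBundle ∞ F L I] (p : M) : ∃ (e : Fin (finrank ℝ F) → Cₛ^∞⟮I; F, L⟯)
    (ε : Fin (finrank ℝ F) → DualSection I F L), ∀ᶠ q in 𝓝 p,
      (∀ i j, ε i q (e j q) = if i = j then (1 : ℝ) else 0) ∧
      ∀ v : L q, v = ∑ i, (ε i q v : ℝ) • e i q := by
  let t := trivializationAt F L p
  have hp : p ∈ t.baseSet := mem_baseSet_trivializationAt F L p
  let b := finBasis ℝ F
  have he : ∀ i, ∃ s : Cₛ^∞⟮I; F, L⟯, ∀ᶠ q in 𝓝 p, s q = t.symmL ℝ q (b i) := fun i =>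
    exists_section_eventuallyEq _ t.open_baseSet hp (contMDiffOn_symmL_apply p (b i))
  have hε : ∀ i, ∃ s : DualSection I F L, ∀ᶠ q in 𝓝 p, s q =
      (b.coord i).toContinuousLinearMap ∘L t.continuousLinearMapAt ℝ q := by
    intro i
    refine exists_section_eventuallyEq (L := Dual L) _ t.open_baseSet hp ?_
    intro q hq
    refine ContMDiffAt.contMDiffWithinAt ?_
    refine contMDiffAt_dual fun y => ?_
    have h1 : ContMDiffAt I (I.prod 𝓘(ℝ, F)) ∞
        (fun q' => TotalSpace.mk' F q' ((trivializationAt F L q).symmL ℝ q' y)) q :=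
      (contMDiffOn_symmL_apply q y).contMDiffAt
        ((trivializationAt F L q).open_baseSet.mem_nhds (mem_baseSet_trivializationAt F L q))
    have h2 := (t.contMDiffAt_section_iff hq).1 h1
    have h3 : ContMDiffAt I 𝓘(ℝ) ∞ (fun q' => (b.coord i).toContinuousLinearMap
        (t (TotalSpace.mk' F q' ((trivializationAt F L q).symmL ℝ q' y))).2) q :=
      (b.coord i).toContinuousLinearMap.contMDiff.contMDiffAt.comp q h2
    refine h3.congr_of_eventuallyEq ?_
    filter_upwards [t.open_baseSet.mem_nhds hq] with q' hq'
    simp [t.coe_linearMapAt_of_mem hq']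
  choose e he using he
  choose ε hε using hε
  refine ⟨e, ε, ?_⟩
  filter_upwards [t.open_baseSet.mem_nhds hp, Filter.eventually_all.2 he,
    Filter.eventually_all.2 hε] with q hq h1 h2
  constructor
  · intro i j
    rw [h1, h2]
    simp [hq, Finsupp.single_apply, eq_comm]
  · intro v
    simp only [h1, h2]
    have h3 := b.sum_repr (t.continuousLinearMapAt ℝ q v)
    have h4 : t.symmL ℝ q (t.continuousLinearMapAt ℝ q v) = v := t.symmL_continuousLinearMapAt hq v
    conv_lhs => rw [← h4, ← h3]
    simp only [map_sum, map_smul]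
    rfl

/-- Every vector of `L` is the value of a global smooth section. -/
theorem exists_section_apply_eq (I : ModelWithCorners ℝ E H) [IsManifold I ∞ M]
    [ContMDiffVectorBundle ∞ F L I] (p : M) (v : L p) : ∃ s : Cₛ^∞⟮I; F, L⟯, s p = v := by
  obtain ⟨e, ε, h⟩ := exists_frame (L := L) (F := F) I p
  refine ⟨∑ i, (ε i p v : ℝ) • e i, ?_⟩
  conv_rhs => rw [h.self_of_nhds.2 v]
  exact map_sum (M := Cₛ^∞⟮I; F, L⟯) { toFun := fun s => s p, map_zero' := rfl, map_add' := fun _ _ => rfl : Cₛ^∞⟮I; F, L⟯ →+ L p} _ _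

/-- Evaluation of smooth sections at `p`. -/
def evalAt (p : M) : Cₛ^∞⟮I; F, L⟯ →ₗ[ℝ] L p where
  toFun s := s p
  map_add' _ _ := rfl
  map_smul' _ _ := rfl

theorem sum_section_apply {ι : Type*} (a : Finset ι) (s : ι → Cₛ^∞⟮I; F, L⟯) (p : M) :
    (∑ i ∈ a, s i) p = ∑ i ∈ a, s i p := map_sum (evalAt p) s a

theorem function_sum_apply {ι : Type*} (a : Finset ι) (f : ι → C^∞⟮I, M; ℝ⟯) (p : M) :
    (∑ i ∈ a, f i) p = ∑ i ∈ a, f i p :=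
  map_sum (ContMDiffMap.evalRingHom (I := I) (n := ∞) (I' := 𝓘(ℝ)) (R := ℝ) p) f a

/-- A `C^∞(M)`-linear operation on sections is local. -/
theorem functional_eq_of_eventuallyEq (φ : Cₛ^∞⟮I; F, L⟯ →ₗ[C^∞⟮I, M; ℝ⟯] C^∞⟮I, M; ℝ⟯)
    {s s' : Cₛ^∞⟮I; F, L⟯} {p : M} (h : ∀ᶠ q in 𝓝 p, s q = s' q) : φ s p = φ s' p := by
  obtain ⟨χ, -, hχ⟩ := (SmoothBumpFunction.nhds_basis_tsupport (I := I) p).mem_iff.1 h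
  let c : C^∞⟮I, M; ℝ⟯ := ⟨χ, χ.contMDiff⟩
  have h1 : c • s = c • s' := by
    ext q
    by_cases hq : q ∈ tsupport χ
    · have : s q = s' q := hχ hq
      simp [this]
    · have : c q = 0 := image_eq_zero_of_notMem_tsupport hq
      simp [this]
  have h2 := congrArg (fun f => f p) (congrArg φ h1)
  have h3 : c p = 1 := χ.eq_one
  simpa [h3] using h2

theorem functional_apply (φ : Cₛ^∞⟮I; F, L⟯ →ₗ[C^∞⟮I, M; ℝ⟯] C^∞⟮I, M; ℝ⟯)
    (e : Fin (finrank ℝ F) → Cₛ^∞⟮I; F, L⟯) (ε : Fin (finrank ℝ F) → DualSection I F L) {p : M}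
    (h : ∀ᶠ q in 𝓝 p, ∀ v : L q, v = ∑ i, (ε i q v : ℝ) • e i q) (s : Cₛ^∞⟮I; F, L⟯) :
    φ s p = ∑ i, (ε i p (s p) : ℝ) * φ (e i) p := by
  have h1 : φ s p = φ (∑ i, pair (ε i) s • e i) p := by
    refine functional_eq_of_eventuallyEq φ ?_
    filter_upwards [h] with q hq
    rw [sum_section_apply]
    exact hq _
  rw [h1, map_sum, function_sum_apply]
  refine Finset.sum_congr rfl fun i _ => ?_
  rw [map_smul]
  rfl


/-- `Γ(L*)` is the dual of the `C^∞(M)`-module `Γ(L)`. -/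
theorem exists_dualSection (φ : Cₛ^∞⟮I; F, L⟯ →ₗ[C^∞⟮I, M; ℝ⟯] C^∞⟮I, M; ℝ⟯) :
    ∃ μ : DualSection I F L, ∀ s, pair μ s = φ s := by
  choose e ε h using exists_frame (L := L) (F := F) I
  let m : ∀ p, Dual L p := fun p => ∑ i, (φ (e p i) p : ℝ) • ε p i p
  have hm : ∀ (s : Cₛ^∞⟮I; F, L⟯) p, (m p (s p) : ℝ) = φ s p := by
    intro s p
    rw [functional_apply φ (e p) (ε p) ((h p).mono fun q hq => hq.2) s]
    simp only [m, _root_.sum_apply, _root_.smul_apply, smul_eq_mul]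
    exact Finset.sum_congr rfl fun i _ => mul_comm _ _
  refine ⟨⟨m, contMDiff_dual fun s => ?_⟩, fun s => ?_⟩
  · simp_rw [hm]
    exact (φ s).contMDiff
  · ext p
    exact hm s p

/-- `Γ(L)` is the dual of the `C^∞(M)`-module `Γ(L*)`. -/
theorem exists_section (ψ : DualSection I F L →ₗ[C^∞⟮I, M; ℝ⟯] C^∞⟮I, M; ℝ⟯) :
    ∃ s : Cₛ^∞⟮I; F, L⟯, ∀ ν, pair ν s = ψ ν := by
  choose e ε h using exists_frame (L := L) (F := F) I
  have key : ∀ (p₀ : M), ∀ᶠ p in 𝓝 p₀, ∀ ν : DualSection I F L,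
      ψ ν p = ∑ i, (ν p (e p₀ i p) : ℝ) * ψ (ε p₀ i) p := by
    intro p₀
    filter_upwards [(h p₀).eventually_nhds] with p hp ν
    have h1 : ψ ν p = ψ (∑ i, pair ν (e p₀ i) • ε p₀ i) p := by
      refine functional_eq_of_eventuallyEq (L := Dual L) ψ ?_
      filter_upwards [hp] with q hq
      rw [sum_section_apply (L := Dual L)]
      ext v
      conv_lhs => rw [hq.2 v]
      simp only [map_sum, map_smul, _root_.sum_apply, smul_section_apply,
        _root_.smul_apply]
      exact Finset.sum_congr rfl fun i _ => mul_comm _ _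
    rw [h1, map_sum, function_sum_apply]
    refine Finset.sum_congr rfl fun i _ => ?_
    rw [map_smul]
    rfl
  let m : ∀ p, L p := fun p => ∑ i, (ψ (ε p i) p : ℝ) • e p i p
  have hm : ∀ (ν : DualSection I F L) p, (ν p (m p) : ℝ) = ψ ν p := by
    intro ν p
    rw [(key p).self_of_nhds ν]
    simp only [m, map_sum, map_smul, smul_eq_mul]
    exact Finset.sum_congr rfl fun i _ => mul_comm _ _
  have hloc : ∀ p₀, ∀ᶠ p in 𝓝 p₀, (∑ i, ψ (ε p₀ i) • e p₀ i) p = m p := by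
    intro p₀
    filter_upwards [h p₀] with p hp
    rw [sum_section_apply, hp.2 (m p)]
    refine Finset.sum_congr rfl fun i _ => ?_
    rw [smul_section_apply, hm]
  refine ⟨⟨m, fun p₀ => ?_⟩, fun ν => ?_⟩
  · refine ((∑ i, ψ (ε p₀ i) • e p₀ i).contMDiff p₀).congr_of_eventuallyEq ?_
    filter_upwards [hloc p₀] with p hp
    rw [hp]
  · ext p
    exact hm ν p

/-- The `1`-form of `L` with the given values on sections. -/
def ofFunctional (φ : Cₛ^∞⟮I; F, L⟯ →ₗ[C^∞⟮I, M; ℝ⟯] C^∞⟮I, M; ℝ⟯) : DualSection I F L :=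
  (exists_dualSection φ).choose

@[simp]
theorem pair_ofFunctional (φ : Cₛ^∞⟮I; F, L⟯ →ₗ[C^∞⟮I, M; ℝ⟯] C^∞⟮I, M; ℝ⟯)
    (s : Cₛ^∞⟮I; F, L⟯) : pair (ofFunctional φ) s = φ s :=
  (exists_dualSection φ).choose_spec s

/-- A multisection of degree `n`, that is, a smooth section of `⋀ⁿ L`. Since the fibres of `L` are
finite dimensional, the elements of `⋀ⁿ L_p` are the alternating `n`-linear forms on `L_p*`, with
`X₁ ∧ ⋯ ∧ Xₙ` corresponding to `(μ₁, …, μₙ) ↦ det ⟨X_i, μ_j⟩`. The section is smooth if its values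
on smooth sections of `L*` are smooth. The value `X(μ₁, …, μₙ)` is `⟨X, μ₁ ∧ ⋯ ∧ μₙ⟩`. -/
structure Multisection (I : ModelWithCorners ℝ E H) (F : Type*) [NormedAddCommGroup F]
    [NormedSpace ℝ F] (L : M → Type*) [TopologicalSpace (TotalSpace F L)]
    [∀ p, AddCommGroup (L p)] [∀ p, Module ℝ (L p)] [∀ p, TopologicalSpace (L p)]
    [∀ p, IsTopologicalAddGroup (L p)] [∀ p, ContinuousSMul ℝ (L p)]
    [FiberBundle F L] [VectorBundle ℝ F L] (n : ℕ) where
  /-- The value of the section at a point. -/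
  toFun : ∀ p, Dual L p [⋀^Fin n]→ₗ[ℝ] ℝ
  contMDiff_toFun : ∀ μ : Fin n → DualSection I F L,
    ContMDiff I 𝓘(ℝ) ∞ (fun p => toFun p (fun i => μ i p))

/-- The smooth function `⟨X, μ₁ ∧ ⋯ ∧ μₙ⟩`. -/
def Multisection.eval {n : ℕ} (X : Multisection I F L n) (μ : Fin n → DualSection I F L) :
    C^∞⟮I, M; ℝ⟯ :=
  ⟨fun p => X.toFun p (fun i => μ i p), X.contMDiff_toFun μ⟩

theorem Multisection.eval_snoc_apply {n : ℕ} (X : Multisection I F L (n + 1))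
    (μ : Fin n → DualSection I F L) (ν : DualSection I F L) (p : M) :
    X.eval (Fin.snoc (α := fun _ => DualSection I F L) μ ν) p =
      X.toFun p (Function.update (Fin.snoc (α := fun _ => Dual L p) (fun i => μ i p) 0)
        (Fin.last n) (ν p)) := by
  show X.toFun p _ = X.toFun p _
  congr 1
  funext i
  refine Fin.lastCases ?_ (fun j => ?_) i <;> simp

/-- The functional `ν ↦ ⟨X, μ₁ ∧ ⋯ ∧ μₙ ∧ ν⟩`. -/
def Multisection.contractFunctional {n : ℕ} (X : Multisection I F L (n + 1))
    (μ : Fin n → DualSection I F L) : DualSection I F L →ₗ[C^∞⟮I, M; ℝ⟯] C^∞⟮I, M; ℝ⟯ where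
  toFun ν := X.eval (Fin.snoc (α := fun _ => DualSection I F L) μ ν)
  map_add' ν ν' := by
    ext p
    simp only [ContMDiffMap.coe_add, Pi.add_apply, eval_snoc_apply, ContMDiffSection.coe_add]
    exact (X.toFun p).map_update_add _ _ _ _
  map_smul' f ν := by
    ext p
    simp only [eval_snoc_apply, smul_section_apply, RingHom.id_apply, smul_eq_mul,
      ContMDiffMap.coe_mul, Pi.mul_apply]
    exact (X.toFun p).map_update_smul _ _ _ _

/-- The contraction `i_{μ₁ ∧ ⋯ ∧ μₙ} X` of an `(n+1)`-section, which is the section of `L` with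
`⟨i_{μ₁ ∧ ⋯ ∧ μₙ} X, ν⟩ = ⟨X, μ₁ ∧ ⋯ ∧ μₙ ∧ ν⟩` for all `ν`. -/
def Multisection.contract {n : ℕ} (X : Multisection I F L (n + 1))
    (μ : Fin n → DualSection I F L) : Cₛ^∞⟮I; F, L⟯ :=
  (exists_section (X.contractFunctional μ)).choose

theorem Multisection.pair_contract {n : ℕ} (X : Multisection I F L (n + 1))
    (μ : Fin n → DualSection I F L) (ν : DualSection I F L) :
    pair ν (X.contract μ) = X.eval (Fin.snoc (α := fun _ => DualSection I F L) μ ν) :=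
  (exists_section (X.contractFunctional μ)).choose_spec ν

/-- The contraction `i_Φ X` with a `1`-form in the first place,
`⟨i_Φ X, μ₁ ∧ ⋯ ∧ μₙ⟩ = ⟨X, Φ ∧ μ₁ ∧ ⋯ ∧ μₙ⟩`. -/
def Multisection.interior {n : ℕ} (Φ : DualSection I F L) (X : Multisection I F L (n + 1)) :
    Multisection I F L n where
  toFun p := (X.toFun p).curryLeft (Φ p)
  contMDiff_toFun μ := by
    refine (X.contMDiff_toFun (Matrix.vecCons Φ μ)).congr fun p => ?_
    show X.toFun p _ = X.toFun p _
    congr 1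
    funext i
    refine Fin.cases ?_ (fun j => ?_) i <;> simp

/-- The derivative `V(f)` of a smooth function along a smooth vector field. -/
def vectorFieldApply (V : Cₛ^∞⟮I; E, (TangentSpace I : M → Type _)⟯) (f : C^∞⟮I, M; ℝ⟯) :
    C^∞⟮I, M; ℝ⟯ :=
  ⟨fun p => mfderiv I 𝓘(ℝ) f p (V p),
    (contMDiff_snd_tangentBundle_modelSpace ℝ 𝓘(ℝ)).comp
      ((f.contMDiff.contMDiff_tangentMap (m := ∞) (by simp)).comp V.contMDiff)⟩


variable (I F L) in
/-- A Lie algebroid structure on the vector bundle `L` over `M`. -/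
structure LieAlgebroid where
  /-- The bracket on the smooth sections of `L`. -/
  bracket : Cₛ^∞⟮I; F, L⟯ →ₗ[ℝ] Cₛ^∞⟮I; F, L⟯ →ₗ[ℝ] Cₛ^∞⟮I; F, L⟯
  /-- The anchor, a `C^∞(M)`-linear map from the sections of `L` to the vector fields on `M`. -/
  anchor : Cₛ^∞⟮I; F, L⟯ →ₗ[C^∞⟮I, M; ℝ⟯] Cₛ^∞⟮I; E, (TangentSpace I : M → Type _)⟯
  bracket_self : ∀ X, bracket X X = 0
  jacobi : ∀ X Y Z, bracket X (bracket Y Z) = bracket (bracket X Y) Z + bracket Y (bracket X Z)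
  leibniz : ∀ (X Y : Cₛ^∞⟮I; F, L⟯) (f : C^∞⟮I, M; ℝ⟯),
    bracket X (f • Y) = f • bracket X Y + vectorFieldApply (anchor X) f • Y

theorem vectorFieldApply_add (V : Cₛ^∞⟮I; E, (TangentSpace I : M → Type _)⟯)
    (f g : C^∞⟮I, M; ℝ⟯) :
    vectorFieldApply V (f + g) = vectorFieldApply V f + vectorFieldApply V g := by
  ext p
  have h := mfderiv_add (f.mdifferentiableAt (x := p)) (g.mdifferentiableAt (x := p))
  exact congrArg (fun A => A (V p)) h

theorem vectorFieldApply_mul (V : Cₛ^∞⟮I; E, (TangentSpace I : M → Type _)⟯)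
    (f g : C^∞⟮I, M; ℝ⟯) :
    vectorFieldApply V (f * g) = f * vectorFieldApply V g + g * vectorFieldApply V f := by
  ext p
  have h := ((f.mdifferentiableAt (x := p)).hasMFDerivAt.mul
    (g.mdifferentiableAt (x := p)).hasMFDerivAt).mfderiv
  exact congrArg (fun A => A (V p)) h

theorem add_vectorFieldApply (V W : Cₛ^∞⟮I; E, (TangentSpace I : M → Type _)⟯)
    (f : C^∞⟮I, M; ℝ⟯) :
    vectorFieldApply (V + W) f = vectorFieldApply V f + vectorFieldApply W f := by
  ext p
  exact map_add (mfderiv I 𝓘(ℝ) f p) (V p) (W p)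

theorem smul_vectorFieldApply (g : C^∞⟮I, M; ℝ⟯)
    (V : Cₛ^∞⟮I; E, (TangentSpace I : M → Type _)⟯) (f : C^∞⟮I, M; ℝ⟯) :
    vectorFieldApply (g • V) f = g * vectorFieldApply V f := by
  ext p
  exact map_smul (mfderiv I 𝓘(ℝ) f p) (g p) (V p)

theorem pair_add (μ : DualSection I F L) (X Y : Cₛ^∞⟮I; F, L⟯) :
    pair μ (X + Y) = pair μ X + pair μ Y := by
  ext p
  exact map_add (μ p) (X p) (Y p)

theorem pair_smul (μ : DualSection I F L) (f : C^∞⟮I, M; ℝ⟯) (X : Cₛ^∞⟮I; F, L⟯) :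
    pair μ (f • X) = f * pair μ X := by
  ext p
  exact map_smul (μ p) (f p) (X p)

namespace LieAlgebroid

variable (A : LieAlgebroid I F L)

/-- The exterior derivative of a function, `⟨df, Y⟩ = a(Y)(f)`. -/
def d (f : C^∞⟮I, M; ℝ⟯) : DualSection I F L :=
  ofFunctional
    { toFun := fun Y => vectorFieldApply (A.anchor Y) f
      map_add' := fun Y Z => by rw [map_add, add_vectorFieldApply]
      map_smul' := fun g Y => by rw [map_smul, smul_vectorFieldApply]; rfl }

/-- The values on sections of the exterior derivative of a `1`-form,
`dμ(X, Y) = a(X)(μ(Y)) - a(Y)(μ(X)) - μ([X, Y])`. -/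
def dForm (μ : DualSection I F L) (X Y : Cₛ^∞⟮I; F, L⟯) : C^∞⟮I, M; ℝ⟯ :=
  vectorFieldApply (A.anchor X) (pair μ Y) - vectorFieldApply (A.anchor Y) (pair μ X) -
    pair μ (A.bracket X Y)

theorem dForm_add (μ : DualSection I F L) (X Y Z : Cₛ^∞⟮I; F, L⟯) :
    A.dForm μ X (Y + Z) = A.dForm μ X Y + A.dForm μ X Z := by
  simp only [dForm, map_add, pair_add, vectorFieldApply_add, add_vectorFieldApply]
  ring

theorem dForm_smul (μ : DualSection I F L) (X : Cₛ^∞⟮I; F, L⟯) (f : C^∞⟮I, M; ℝ⟯)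
    (Y : Cₛ^∞⟮I; F, L⟯) : A.dForm μ X (f • Y) = f * A.dForm μ X Y := by
  simp only [dForm, map_smul, pair_add, pair_smul, A.leibniz, vectorFieldApply_mul,
    smul_vectorFieldApply]
  ring

/-- The contraction `i_X dμ`. -/
def interiorD (X : Cₛ^∞⟮I; F, L⟯) (μ : DualSection I F L) : DualSection I F L :=
  ofFunctional
    { toFun := fun Y => A.dForm μ X Y
      map_add' := A.dForm_add μ X
      map_smul' := A.dForm_smul μ X }

/-- The Lie derivative of a `1`-form, `£_X μ = i_X dμ + d(i_X μ)`. -/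
def lieDeriv (X : Cₛ^∞⟮I; F, L⟯) (μ : DualSection I F L) : DualSection I F L :=
  A.interiorD X μ + A.d (pair μ X)

/-- A `1`-form `Φ` is a `1`-cocycle if `dΦ = 0`. -/
def IsCocycle (Φ : DualSection I F L) : Prop :=
  ∀ X Y, A.dForm Φ X Y = 0

/-- The deformed exterior derivative of a function, `d^Φ f = df + f Φ`. -/
def dPhi (Φ : DualSection I F L) (f : C^∞⟮I, M; ℝ⟯) : DualSection I F L :=
  A.d f + f • Φ

/-- The contraction `i_X d^Φ μ` for `d^Φ μ = dμ + Φ ∧ μ`. -/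
def interiorDPhi (Φ : DualSection I F L) (X : Cₛ^∞⟮I; F, L⟯) (μ : DualSection I F L) :
    DualSection I F L :=
  A.interiorD X μ + (pair Φ X • μ - pair μ X • Φ)

/-- The deformed Lie derivative of a `1`-form, `£^Φ_X μ = i_X d^Φ μ + d^Φ (i_X μ)`. -/
def lieDerivPhi (Φ : DualSection I F L) (X : Cₛ^∞⟮I; F, L⟯) (μ : DualSection I F L) :
    DualSection I F L :=
  A.interiorDPhi Φ X μ + A.dPhi Φ (pair μ X)

end LieAlgebroid

/-- The function `ι_μ` on the total space of `L` that is linear along the fibres and given by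
`ι_μ(v) = ⟨μ(p), v⟩` for `v ∈ L_p`. -/
def iota (μ : DualSection I F L) (v : TotalSpace F L) : ℝ :=
  μ v.proj v.2

theorem contMDiff_iota (μ : DualSection I F L) :
    ContMDiff (I.prod 𝓘(ℝ, F)) 𝓘(ℝ) ∞ (iota μ) := by
  intro v
  have h1 : ContMDiffAt (I.prod 𝓘(ℝ, F)) (I.prod 𝓘(ℝ, F →L[ℝ] ℝ)) ∞
      (fun w : TotalSpace F L => TotalSpace.mk' (F →L[ℝ] ℝ) w.proj (μ w.proj)) v :=
    (μ.contMDiff.comp (Bundle.contMDiff_proj L)) v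
  have h := h1.clm_bundle_apply (v := fun w : TotalSpace F L => w.2) (b := TotalSpace.proj)
    (contMDiffAt_id (x := v))
  exact ((contMDiffAt_totalSpace (F := ℝ) (E := Bundle.Trivial M ℝ)).1 h).2

/-- A tangent vector of the total space of `L`. -/
abbrev TVec (I : ModelWithCorners ℝ E H) (v : TotalSpace F L) : Type _ :=
  TangentSpace (I.prod 𝓘(ℝ, F)) v

/-- The differential at `v` of a real function on the total space of `L`. -/
def diff (I : ModelWithCorners ℝ E H) (h : TotalSpace F L → ℝ) (v : TotalSpace F L) :
    TVec I v →L[ℝ] ℝ :=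
  mfderiv (I.prod 𝓘(ℝ, F)) 𝓘(ℝ) h v

/-- The vertical lift `L_p → T_v L` for `v ∈ L_p`: the derivative at `v` of the inclusion of the
fibre `L_p`, which is identified with `F` by a trivialization. -/
def vert (I : ModelWithCorners ℝ E H) (v : TotalSpace F L) : L v.proj →L[ℝ] TVec I v :=
  (mfderiv 𝓘(ℝ, F) (I.prod 𝓘(ℝ, F))
    (fun y : F => TotalSpace.mk' F v.proj ((trivializationAt F L v.proj).symmL ℝ v.proj y))
    ((trivializationAt F L v.proj).continuousLinearMapAt ℝ v.proj v.2) : F →L[ℝ] TVec I v) ∘L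
  (trivializationAt F L v.proj).continuousLinearMapAt ℝ v.proj

theorem contMDiff_fibreInclusion (p : M) :
    ContMDiff 𝓘(ℝ, F) (I.prod 𝓘(ℝ, F)) ∞
      (fun y : F => TotalSpace.mk' F p ((trivializationAt F L p).symmL ℝ p y)) := by
  intro y
  rw [contMDiffAt_totalSpace]
  refine ⟨contMDiffAt_const, ?_⟩
  refine (contMDiffAt_id (x := y)).congr_of_eventuallyEq (Filter.Eventually.of_forall fun z => ?_)
  have hp := mem_baseSet_trivializationAt F L p
  have h := (trivializationAt F L p).continuousLinearMapAt_symmL (R := ℝ) hp z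
  rw [Trivialization.continuousLinearMapAt_apply,
    (trivializationAt F L p).coe_linearMapAt_of_mem hp] at h
  exact h

theorem diff_iota_vert (μ : DualSection I F L) (v : TotalSpace F L) (w : L v.proj) :
    diff I (iota μ) v (vert I v w) = μ v.proj w := by
  have hp := mem_baseSet_trivializationAt F L v.proj
  have h := mfderiv_comp_apply_of_eq
    (f := fun y : F => TotalSpace.mk' F v.proj ((trivializationAt F L v.proj).symmL ℝ v.proj y))
    (x := (trivializationAt F L v.proj).continuousLinearMapAt ℝ v.proj v.2) (y := v)
    (((contMDiff_iota μ).mdifferentiable (by simp)) v)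
    ((contMDiff_fibreInclusion (I := I) v.proj).mdifferentiable (by simp) _)
    (by rw [(trivializationAt F L v.proj).symmL_continuousLinearMapAt hp])
    ((trivializationAt F L v.proj).continuousLinearMapAt ℝ v.proj w)
  refine h.symm.trans ?_
  have h2 : (iota μ ∘ fun y : F =>
      TotalSpace.mk' F v.proj ((trivializationAt F L v.proj).symmL ℝ v.proj y)) =
      ((μ v.proj : L v.proj →L[ℝ] ℝ) ∘L (trivializationAt F L v.proj).symmL ℝ v.proj :
        F →L[ℝ] ℝ) := rfl
  rw [h2, mfderiv_eq_fderiv, ContinuousLinearMap.fderiv]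
  show μ v.proj ((trivializationAt F L v.proj).symmL ℝ v.proj _) = _
  rw [(trivializationAt F L v.proj).symmL_continuousLinearMapAt hp]

theorem mfderiv_proj_vert (v : TotalSpace F L) (w : L v.proj) :
    mfderiv (I.prod 𝓘(ℝ, F)) I (TotalSpace.proj : TotalSpace F L → M) v (vert I v w) = 0 := by
  have hp := mem_baseSet_trivializationAt F L v.proj
  have h := mfderiv_comp_apply_of_eq (I'' := I) (g := (TotalSpace.proj : TotalSpace F L → M))
    (f := fun y : F => TotalSpace.mk' F v.proj ((trivializationAt F L v.proj).symmL ℝ v.proj y))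
    (x := (trivializationAt F L v.proj).continuousLinearMapAt ℝ v.proj v.2) (y := v)
    (((Bundle.contMDiff_proj (n := ∞) L).mdifferentiable (by simp)) v)
    ((contMDiff_fibreInclusion (I := I) v.proj).mdifferentiable (by simp) _)
    (by rw [(trivializationAt F L v.proj).symmL_continuousLinearMapAt hp])
    ((trivializationAt F L v.proj).continuousLinearMapAt ℝ v.proj w)
  refine h.symm.trans ?_
  have h2 : ((TotalSpace.proj : TotalSpace F L → M) ∘ fun y : F =>
      TotalSpace.mk' F v.proj ((trivializationAt F L v.proj).symmL ℝ v.proj y)) =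
      fun _ => v.proj := rfl
  rw [h2, mfderiv_const]
  rfl

namespace LieAlgebroid

variable (A : LieAlgebroid I F L)

theorem pair_d (f : C^∞⟮I, M; ℝ⟯) (Y : Cₛ^∞⟮I; F, L⟯) :
    pair (A.d f) Y = vectorFieldApply (A.anchor Y) f := pair_ofFunctional _ _

theorem pair_interiorD (X : Cₛ^∞⟮I; F, L⟯) (μ : DualSection I F L) (Y : Cₛ^∞⟮I; F, L⟯) :
    pair (A.interiorD X μ) Y = A.dForm μ X Y := pair_ofFunctional _ _

theorem pair_lieDeriv (X : Cₛ^∞⟮I; F, L⟯) (μ : DualSection I F L) (Y : Cₛ^∞⟮I; F, L⟯) :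
    pair (A.lieDeriv X μ) Y =
      vectorFieldApply (A.anchor X) (pair μ Y) - pair μ (A.bracket X Y) := by
  have h : pair (A.lieDeriv X μ) Y = pair (A.interiorD X μ) Y + pair (A.d (pair μ X)) Y := rfl
  rw [h, pair_interiorD, pair_d, dForm]
  ring

/-- The tangent vector `ξ` at `v` is the value of the complete lift `X^c` of the section `X`:
`X^c(ι_μ) = ι_{£_X μ}` for all `μ`, and `X^c` projects to the anchor `a(X)`. -/
def IsLiftVec (X : Cₛ^∞⟮I; F, L⟯) (v : TotalSpace F L) (ξ : TVec I v) : Prop :=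
  (∀ μ : DualSection I F L, diff I (iota μ) v ξ = iota (A.lieDeriv X μ) v) ∧
    mfderiv (I.prod 𝓘(ℝ, F)) I (TotalSpace.proj : TotalSpace F L → M) v ξ = A.anchor X v.proj

theorem exists_isLiftVec (X : Cₛ^∞⟮I; F, L⟯) (v : TotalSpace F L) :
    ∃ ξ : TVec I v, A.IsLiftVec X v ξ := by
  obtain ⟨p, w⟩ := v
  obtain ⟨s, rfl⟩ := exists_section_apply_eq (F := F) I p w
  have hs : MDifferentiableAt I (I.prod 𝓘(ℝ, F)) (fun q => TotalSpace.mk' F q (s q)) p :=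
    s.mdifferentiableAt
  let ζ : TVec I (TotalSpace.mk' F p (s p)) :=
    mfderiv I (I.prod 𝓘(ℝ, F)) (fun q => TotalSpace.mk' F q (s q)) p (A.anchor X p)
  refine ⟨ζ - vert I (TotalSpace.mk' F p (s p)) (A.bracket X s p), fun μ => ?_, ?_⟩
  · rw [map_sub, diff_iota_vert]
    have h := mfderiv_comp_apply (I'' := 𝓘(ℝ)) (g := iota μ)
      (f := fun q => TotalSpace.mk' F q (s q)) p
      (((contMDiff_iota μ).mdifferentiable (by simp)) _) hs (A.anchor X p)
    have h1 : diff I (iota μ) (TotalSpace.mk' F p (s p)) ζ =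
        vectorFieldApply (A.anchor X) (pair μ s) p := h.symm
    have h2 := congrArg (fun f => f p) (A.pair_lieDeriv X μ s)
    rw [h1]
    exact h2.symm
  · have h := mfderiv_comp_apply (I'' := I) (g := (TotalSpace.proj : TotalSpace F L → M))
      (f := fun q => TotalSpace.mk' F q (s q)) p
      (((Bundle.contMDiff_proj (n := ∞) L).mdifferentiable (by simp)) _) hs (A.anchor X p)
    have h2 : ((TotalSpace.proj : TotalSpace F L → M) ∘ fun q => TotalSpace.mk' F q (s q)) = id :=
      rfl
    rw [h2, mfderiv_id] at h
    refine (map_sub _ _ _).trans ?_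
    rw [mfderiv_proj_vert, sub_zero]
    exact h.symm

/-- The value at `v` of the complete lift `X^c` of a section `X` of `L`. -/
def liftVec (X : Cₛ^∞⟮I; F, L⟯) (v : TotalSpace F L) : TVec I v :=
  (A.exists_isLiftVec X v).choose

end LieAlgebroid

/-- The multivector `x₁ ∧ ⋯ ∧ xₙ`, as the alternating form `(θ₁, …, θₙ) ↦ det (θ_j(x_i))`. -/
def wedge {W : Type*} [AddCommGroup W] [Module ℝ W] [TopologicalSpace W] {n : ℕ} (x : Fin n → W) :
    (W →L[ℝ] ℝ) [⋀^Fin n]→ₗ[ℝ] ℝ :=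
  Matrix.detRowAlternating.compLinearMap
    (LinearMap.pi fun i => LinearMap.applyₗ (x i) ∘ₗ ContinuousLinearMap.coeLM ℝ)

theorem wedge_apply {W : Type*} [AddCommGroup W] [Module ℝ W] [TopologicalSpace W] {n : ℕ}
    (x : Fin n → W) (θ : Fin n → W →L[ℝ] ℝ) :
    wedge x θ = (Matrix.of fun i j => θ j (x i)).det := by
  rw [← Matrix.det_transpose]
  rfl

/-- The exterior product `x ∧ Z` of a vector and a multivector. -/
def vecWedge {W : Type*} [AddCommGroup W] [Module ℝ W] [TopologicalSpace W] {n : ℕ} (x : W)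
    (Z : (W →L[ℝ] ℝ) [⋀^Fin n]→ₗ[ℝ] ℝ) : (W →L[ℝ] ℝ) [⋀^Fin (n + 1)]→ₗ[ℝ] ℝ :=
  AlternatingMap.alternatizeUncurryFin
    ((LinearMap.applyₗ x ∘ₗ ContinuousLinearMap.coeLM ℝ).smulRight Z)

theorem vecWedge_apply {W : Type*} [AddCommGroup W] [Module ℝ W] [TopologicalSpace W] {n : ℕ}
    (x : W) (Z : (W →L[ℝ] ℝ) [⋀^Fin n]→ₗ[ℝ] ℝ) (θ : Fin (n + 1) → (W →L[ℝ] ℝ)) :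
    vecWedge x Z θ = ∑ j : Fin (n + 1), (-1 : ℝ) ^ (j : ℕ) * (θ j x * Z (j.removeNth θ)) := by
  rw [vecWedge, AlternatingMap.alternatizeUncurryFin_apply]
  refine Finset.sum_congr rfl fun j _ => ?_
  simp [zsmul_eq_mul]

/-- An expression of the multisection `X` near `p` as a finite sum of products
`f Y₁ ∧ ⋯ ∧ Yₙ` of smooth functions and smooth sections of `L`. -/
structure LocalExpression {n : ℕ} (X : Multisection I F L n) (p : M) where
  /-- The index type of the sum. -/
  ι : Type
  /-- The index type is finite. -/
  fintype : Fintype ι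
  /-- The functions. -/
  coeff : ι → C^∞⟮I, M; ℝ⟯
  /-- The sections of `L`. -/
  vec : ι → Fin n → Cₛ^∞⟮I; F, L⟯
  eventually_eq : ∀ᶠ q in 𝓝 p, X.toFun q = ∑ a, coeff a q • wedge (fun i => vec a i q)

theorem nonempty_localExpression {n : ℕ} (X : Multisection I F L n) (p : M) :
    Nonempty (LocalExpression X p) := by
  obtain ⟨e, ε, h⟩ := exists_frame (L := L) (F := F) I p
  refine ⟨⟨Fin n → Fin (finrank ℝ F), inferInstance,
    fun J => ((n.factorial : ℝ)⁻¹) • X.eval (fun i => ε (J i)), fun J i => e (J i), ?_⟩⟩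
  filter_upwards [h] with q hq
  ext θ
  have hθ : ∀ j, θ j = ∑ i, (θ j (e i q) : ℝ) • ε i q := by
    intro j
    ext w
    conv_lhs => rw [hq.2 w]
    simp only [map_sum, map_smul, _root_.sum_apply, _root_.smul_apply]
    exact Finset.sum_congr rfl fun i _ => mul_comm _ _
  have key : ∀ σ : Equiv.Perm (Fin n), X.toFun q (fun j => θ (σ j)) =
      ∑ J : Fin n → Fin (finrank ℝ F), (∏ j, (θ (σ j) (e (J j) q) : ℝ)) *
        X.toFun q (fun j => ε (J j) q) := by
    intro σ
    conv_lhs => rw [show (fun j => θ (σ j)) = fun j => ∑ i, (θ (σ j) (e i q) : ℝ) • ε i q from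
      funext fun j => hθ (σ j)]
    refine ((X.toFun q).toMultilinearMap.map_sum
      (fun j i => (θ (σ j) (e i q) : ℝ) • ε i q)).trans ?_
    refine Finset.sum_congr rfl fun J _ => ?_
    exact (X.toFun q).toMultilinearMap.map_smul_univ (fun j => (θ (σ j) (e (J j) q) : ℝ))
      (fun j => ε (J j) q)
  have hfac : (n.factorial : ℝ) * X.toFun q θ = ∑ σ : Equiv.Perm (Fin n),
      ((Equiv.Perm.sign σ : ℤ) : ℝ) * X.toFun q (fun j => θ (σ j)) := by
    have : ∀ σ : Equiv.Perm (Fin n),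
        ((Equiv.Perm.sign σ : ℤ) : ℝ) * X.toFun q (fun j => θ (σ j)) = X.toFun q θ := by
      intro σ
      have h1 := (X.toFun q).map_perm θ σ
      have h2 : X.toFun q (fun j => θ (σ j)) =
        ((Equiv.Perm.sign σ : ℤ) : ℝ) * X.toFun q θ := by
        rw [← zsmul_eq_mul]
        exact h1
      rw [h2, ← mul_assoc, ← Int.cast_mul, ← Units.val_mul, Int.units_mul_self]
      simp
    rw [Finset.sum_congr rfl fun σ _ => this σ]
    simp [Fintype.card_perm]
  have hdet : ∀ J : Fin n → Fin (finrank ℝ F), wedge (fun i => e (J i) q) θ =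
      ∑ σ : Equiv.Perm (Fin n), ((Equiv.Perm.sign σ : ℤ) : ℝ) *
        ∏ j, (θ (σ j) (e (J j) q) : ℝ) := by
    intro J
    rw [wedge_apply, ← Matrix.det_transpose, Matrix.det_apply']
    rfl
  have hne : (n.factorial : ℝ) ≠ 0 := Nat.cast_ne_zero.2 n.factorial_ne_zero
  have hX : X.toFun q θ = (n.factorial : ℝ)⁻¹ * ((n.factorial : ℝ) * X.toFun q θ) := by
    rw [← mul_assoc, inv_mul_cancel₀ hne, one_mul]
  rw [hX, hfac]
  simp only [key]
  have hsum : ∀ g : (Fin n → Fin (finrank ℝ F)) → (Dual L q [⋀^Fin n]→ₗ[ℝ] ℝ),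
      (∑ J, g J) θ = ∑ J, g J θ := fun g =>
    map_sum (M := Dual L q [⋀^Fin n]→ₗ[ℝ] ℝ)
      { toFun := fun G => G θ, map_zero' := rfl, map_add' := fun _ _ => rfl :
        (Dual L q [⋀^Fin n]→ₗ[ℝ] ℝ) →+ ℝ } _ _
  rw [hsum]
  have hR : ∀ J : Fin n → Fin (finrank ℝ F),
      ((((n.factorial : ℝ)⁻¹) • X.eval (fun i => ε (J i))) q •
        wedge (fun i => e (J i) q) : Dual L q [⋀^Fin n]→ₗ[ℝ] ℝ) θ =
      (n.factorial : ℝ)⁻¹ * (X.toFun q (fun j => ε (J j) q) *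
        ∑ σ : Equiv.Perm (Fin n), ((Equiv.Perm.sign σ : ℤ) : ℝ) *
        ∏ j, (θ (σ j) (e (J j) q) : ℝ)) := by
    intro J
    rw [← hdet J, ← mul_assoc]
    rfl
  rw [Finset.sum_congr rfl fun J _ => hR J, ← Finset.mul_sum]
  congr 1
  simp only [Finset.mul_sum]
  rw [Finset.sum_comm]
  refine Finset.sum_congr rfl fun J _ => Finset.sum_congr rfl fun σ _ => ?_
  ring

/-- A multivector at the point `v` of the total space of `L`, as an alternating form on the
cotangent space. -/
abbrev MVec (I : ModelWithCorners ℝ E H) (n : ℕ) (v : TotalSpace F L) : Type _ :=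
  (TVec I v →L[ℝ] ℝ) [⋀^Fin n]→ₗ[ℝ] ℝ

/-- The vertical lift `X^v` of a multisection. -/
def Multisection.verticalLift {n : ℕ} (X : Multisection I F L n) (v : TotalSpace F L) :
    MVec I n v :=
  (X.toFun v.proj).compLinearMap
    { toFun := fun θ => (θ ∘L vert I v : L v.proj →L[ℝ] ℝ)
      map_add' := fun _ _ => rfl
      map_smul' := fun _ _ => rfl }

/-- The Liouville vector field `∇`. -/
def liouville (I : ModelWithCorners ℝ E H) [IsManifold I ∞ M] [ContMDiffVectorBundle ∞ F L I]
    (v : TotalSpace F L) : TVec I v :=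
  vert I v v.2

namespace LieAlgebroid

variable (A : LieAlgebroid I F L)

/-- The value at `v` of the complete lift of `∑ f Y₁ ∧ ⋯ ∧ Yₙ`, computed from the rules
`f^c = ι_{df}`, `(X ∧ Y)^c = X^c ∧ Y^v + X^v ∧ Y^c` and additivity:
`∑ (ι_{df} Y₁^v ∧ ⋯ ∧ Yₙ^v + f ∑ₖ Y₁^v ∧ ⋯ ∧ Y_k^c ∧ ⋯ ∧ Yₙ^v)`. -/
def completeLiftOf {n : ℕ} {X : Multisection I F L n} {v : TotalSpace F L}
    (P : LocalExpression X v.proj) : MVec I n v :=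
  letI := P.fintype
  ∑ a, (iota (A.d (P.coeff a)) v • wedge (fun i => vert I v (P.vec a i v.proj)) +
    P.coeff a v.proj • ∑ k, wedge (Function.update (fun i => vert I v (P.vec a i v.proj)) k
      (A.liftVec (P.vec a k) v)))

/-- The complete lift `X^c` of a multisection `X` of `L`, a multivector field on the total space
of `L`. It is local in `X` and is the additive extension, by
`(X ∧ Y)^c = X^c ∧ Y^v + X^v ∧ Y^c`, of `f^c = ι_{df}` for functions and of `X^c(ι_μ) = ι_{£_X μ}`
for sections; so it is computed from any expression of `X` near the point, and it does not depend
on the expression. -/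
def completeLift {n : ℕ} (X : Multisection I F L n) (v : TotalSpace F L) : MVec I n v :=
  A.completeLiftOf (nonempty_localExpression X v.proj).some

/-- The Poisson lift `X^c_Φ = X^c - x ι_Φ X^v + ∇ ∧ (i_Φ X)^v` of a multisection `X` of degree
`n = x + 1`, where `∇` is the Liouville vector field. For `n = 0`, that is, for a function `X`
and `x = -1`, the last term is absent. -/
def poissonLift (Φ : DualSection I F L) : ∀ {n : ℕ}, Multisection I F L n →
    ∀ v : TotalSpace F L, MVec I n v
  | 0, X, v => A.completeLift X v + iota Φ v • X.verticalLift v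
  | x + 1, X, v => A.completeLift X v - ((x : ℝ) * iota Φ v) • X.verticalLift v +
      vecWedge (liouville I v) ((X.interior Φ).verticalLift v)

end LieAlgebroid

/-- The section `ν` of `L*` is the bracket `[μ₁, …, μₙ]` induced by the multivector field `W` on the
total space of `L`: `ι_ν = ⟨W, dι_{μ₁} ∧ ⋯ ∧ dι_{μₙ}⟩`. -/
def IsInducedBracket {n : ℕ} (W : ∀ v : TotalSpace F L, MVec I n v) (μ : Fin n → DualSection I F L)
    (ν : DualSection I F L) : Prop :=
  ∀ v, iota ν v = W v (fun i => diff I (iota (μ i)) v)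

/-- The induced bracket is uniquely determined. -/
theorem IsInducedBracket.unique {n : ℕ} {W : ∀ v : TotalSpace F L, MVec I n v}
    {μ : Fin n → DualSection I F L} {ν ρ : DualSection I F L} (h : IsInducedBracket W μ ν)
    (k : IsInducedBracket W μ ρ) : ν = ρ := by
  ext p w
  exact (h (TotalSpace.mk' F p w)).trans (k (TotalSpace.mk' F p w)).symm

end JacobiAlgebroid
end

/-! Two functions on the total space of `L` agree if they agree along every smooth section `s`, so
both sides are evaluated at `s p`, where `ι_μ` becomes `⟨μ, s⟩`. The proof rests on the identity
`⟨£_Y μ, s⟩ = a(s)⟨μ, Y⟩ - ⟨i_s dμ, Y⟩` (`pair_lieDeriv_eq`), which trades the derivative along `Y`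
for one along the fixed section `s`.

Write `X` locally as a sum of terms `f Y₁ ∧ ⋯ ∧ Yₙ`, so that `X(μ)` is a sum of terms `f det ⟨μ_j,
Y_i⟩`. The complete lift differentiates `f` and replaces one row at a time by the values `⟨£_{Y_i}
μ_j, s⟩`. By the identity and the Leibniz rule for determinants, the derivatives add up to
`a(s)(X(μ))`. What is left replaces rows by `⟨i_s dμ_j, Y_i⟩`; the same sum arises from replacing
columns, that is, arguments. Hence (`completeLiftOf_diff_iota`) `X^c(dι_μ)` at `s p` is `a(s)(X(μ))
- ∑ₖ X(…, i_s dμ_k, …)`.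

The same identity applied to `£_{X_k} μ_k`, with its sign, gives `a(s)(X(μ)) - X(…, i_s dμ_k, …)`
for each of the `x + 1` values of `k`; the term `-x d^Φ X(μ)` removes the `x` surplus copies of
`a(s)(X(μ))`. The terms in `Φ` match one by one: `£^Φ_Y μ = £_Y μ + ⟨Φ, Y⟩ μ` accounts for `∇ ∧ (i_Φ
X)^v`, and the summand `X(μ) Φ` of `d^Φ X(μ)` accounts for `x ι_Φ X^v`.

For `μ_k = d^Φ f_k` the cocycle condition gives `d^Φ d^Φ f_k = 0`, so each of the `x + 1` signed Lie
derivatives equals `d^Φ X(μ)`, and `x + 1 - x = 1` copy survives. -/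

/-! ### Determinants and alternating maps. -/

/-- Replacing the rows of `A` one at a time by those of `B` yields the same sum of determinants as
replacing the columns. -/
theorem Matrix.sum_det_updateRow_eq_sum_det_updateCol {n R : Type*} [Fintype n] [DecidableEq n]
    [CommRing R] (A B : Matrix n n R) :
    ∑ i, (A.updateRow i (B i)).det = ∑ k, (A.updateCol k fun i => B i k).det := by
  -- By Cramer's rule both sums are traces, of `B * adj A` and of `adj A * B`.
  have h1 : ∀ i, (A.updateRow i (B i)).det = (B * A.adjugate) i i := fun i => by
    rw [← Matrix.cramer_transpose_apply, Matrix.cramer_eq_adjugate_mulVec,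
      ← Matrix.adjugate_transpose, Matrix.mulVec_transpose]
    rfl
  have h2 : ∀ k, (A.updateCol k fun i => B i k).det = (A.adjugate * B) k k := fun k => by
    rw [← Matrix.cramer_apply, Matrix.cramer_eq_adjugate_mulVec]
    rfl
  simp only [h1, h2]
  exact Matrix.trace_mul_comm B A.adjugate

/-- The Leibniz rule for finite products. -/
theorem Derivation.map_prod_eq_sum_update {k R ι : Type*} [CommRing k] [CommRing R] [Algebra k R]
    [DecidableEq ι] (D : Derivation k R R) (s : Finset ι) (f : ι → R) :
    D (∏ i ∈ s, f i) = ∑ j ∈ s, ∏ i ∈ s, Function.update f j (D (f j)) i := by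
  induction s using Finset.induction_on with
  | empty => simp
  | insert a s ha ih =>
    rw [Finset.prod_insert ha, D.leibniz, ih, Finset.sum_insert ha, Finset.prod_insert ha,
      Function.update_self, Finset.prod_update_of_notMem ha, Finset.smul_sum, add_comm,
      smul_eq_mul, mul_comm]
    congr 1
    refine Finset.sum_congr rfl fun j hj => ?_
    rw [Finset.prod_insert ha, Function.update_of_ne (ne_of_mem_of_not_mem hj ha).symm, smul_eq_mul]

/-- The Leibniz rule for determinants. -/
theorem Derivation.map_det {k R n : Type*} [CommRing k] [CommRing R] [Algebra k R] [Fintype n]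
    [DecidableEq n] (D : Derivation k R R) (A : Matrix n n R) :
    D A.det = ∑ i, (A.updateRow i fun j => D (A i j)).det := by
  -- Each product is indexed by rows, so that differentiating one factor alters exactly one row.
  have h : ∀ B : Matrix n n R, B.det =
      ∑ σ : Equiv.Perm n, Equiv.Perm.sign σ • ∏ i, B i (σ i) := fun B => by
    rw [← Matrix.det_transpose, Matrix.det_apply]
    rfl
  have hs : ∀ (σ : Equiv.Perm n) (r : R),
      D (Equiv.Perm.sign σ • r) = Equiv.Perm.sign σ • D r := fun σ r => by
    simp only [Units.smul_def, map_zsmul]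
  simp only [h, map_sum, hs, D.map_prod_eq_sum_update, Finset.smul_sum]
  rw [Finset.sum_comm]
  refine Finset.sum_congr rfl fun i _ => Finset.sum_congr rfl fun σ _ => ?_
  congr 1
  refine Finset.prod_congr rfl fun j _ => ?_
  by_cases hj : j = i
  · subst hj
    simp
  · simp [hj]

/-- Replacing the `k`-th argument of an alternating map, expressed by omitting it and inserting the
new argument in the first place. -/
theorem AlternatingMap.map_update_eq_vecCons {R V W : Type*} [CommRing R] [AddCommGroup V]
    [Module R V] [AddCommGroup W] [Module R W] {n : ℕ} (f : V [⋀^Fin (n + 1)]→ₗ[R] W)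
    (m : Fin (n + 1) → V) (k : Fin (n + 1)) (v : V) :
    f (Function.update m k v) = (-1 : ℤ) ^ (k : ℕ) • f (Matrix.vecCons v (k.removeNth m)) := by
  -- Inserting `v` at `k` costs a second sign `(-1)^k`, which cancels the first.
  rw [← f.neg_one_pow_smul_map_insertNth k v (k.removeNth m), smul_smul, ← mul_pow]
  simp [Fin.insertNth_removeNth]

/-- Replacing the `k`-th argument of an alternating map, expressed by omitting it and inserting the
new argument in the last place. -/
theorem AlternatingMap.map_update_eq_snoc {R V W : Type*} [CommRing R] [AddCommGroup V]
    [Module R V] [AddCommGroup W] [Module R W] {n : ℕ} (f : V [⋀^Fin (n + 1)]→ₗ[R] W)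
    (m : Fin (n + 1) → V) (k : Fin (n + 1)) (v : V) :
    f (Function.update m k v) =
      (-1 : ℤ) ^ (n + (k : ℕ)) • f (Fin.snoc (α := fun _ => V) (k.removeNth m) v) := by
  -- The argument moves from place `k` to the first, with sign `(-1)^k`, and then past the other
  -- `n`, with sign `(-1)^n`.
  rw [f.map_update_eq_vecCons,
    ← f.neg_one_pow_smul_map_insertNth (Fin.last n) v (k.removeNth m), smul_smul, ← pow_add,
    Fin.insertNth_last', add_comm]
  simp

noncomputable section

namespace JacobiAlgebroid

set_option linter.unusedSectionVars false

variable {E : Type*} [NormedAddCommGroup E] [NormedSpace ℝ E] [FiniteDimensional ℝ E]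
  {H : Type*} [TopologicalSpace H] {I : ModelWithCorners ℝ E H}
  {M : Type*} [TopologicalSpace M] [ChartedSpace H M] [IsManifold I ∞ M] [T2Space M]
  {F : Type*} [NormedAddCommGroup F] [NormedSpace ℝ F] [FiniteDimensional ℝ F]
  {L : M → Type*} [TopologicalSpace (TotalSpace F L)]
  [∀ p, AddCommGroup (L p)] [∀ p, Module ℝ (L p)] [∀ p, TopologicalSpace (L p)]
  [∀ p, IsTopologicalAddGroup (L p)] [∀ p, ContinuousSMul ℝ (L p)]
  [FiberBundle F L] [VectorBundle ℝ F L] [ContMDiffVectorBundle ∞ F L I]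

/-! ### Vector fields as derivations, and pairings. -/

/-- A vector field as a derivation of the algebra of smooth functions. -/
def vectorFieldDerivation (V : Cₛ^∞⟮I; E, (TangentSpace I : M → Type _)⟯) :
    Derivation ℝ C^∞⟮I, M; ℝ⟯ C^∞⟮I, M; ℝ⟯ :=
  Derivation.mk'
    { toFun := vectorFieldApply V
      map_add' := vectorFieldApply_add V
      map_smul' := fun c f => by
        ext p
        have h := const_smul_mfderiv (f.mdifferentiableAt (x := p)) c
        exact congrArg (fun A => A (V p)) h }
    (vectorFieldApply_mul V)

theorem vectorFieldDerivation_apply (V : Cₛ^∞⟮I; E, (TangentSpace I : M → Type _)⟯)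
    (f : C^∞⟮I, M; ℝ⟯) : vectorFieldDerivation V f = vectorFieldApply V f := rfl

theorem vectorFieldApply_smul (V : Cₛ^∞⟮I; E, (TangentSpace I : M → Type _)⟯) (c : ℝ)
    (f : C^∞⟮I, M; ℝ⟯) : vectorFieldApply V (c • f) = c • vectorFieldApply V f :=
  (vectorFieldDerivation V).map_smul c f

/-- The derivative along a vector field is local. -/
theorem vectorFieldApply_apply_congr (V : Cₛ^∞⟮I; E, (TangentSpace I : M → Type _)⟯)
    {f g : C^∞⟮I, M; ℝ⟯} {p : M} (h : ∀ᶠ q in 𝓝 p, f q = g q) :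
    vectorFieldApply V f p = vectorFieldApply V g p :=
  congrArg (fun A => A (V p)) (Filter.EventuallyEq.mfderiv_eq (I := I) (I' := 𝓘(ℝ)) (f₁ := f) (f := g) h)

theorem dualSection_ext {μ ν : DualSection I F L} (h : ∀ s, pair μ s = pair ν s) : μ = ν := by
  ext p w
  obtain ⟨s, rfl⟩ := exists_section_apply_eq (F := F) I p w
  exact congrArg (fun f => f p) (h s)

theorem pair_neg (μ : DualSection I F L) (X : Cₛ^∞⟮I; F, L⟯) : pair μ (-X) = -pair μ X := by
  ext p
  exact map_neg (μ p) (X p)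

theorem pair_add_left (μ ν : DualSection I F L) (s : Cₛ^∞⟮I; F, L⟯) :
    pair (μ + ν) s = pair μ s + pair ν s := rfl

theorem pair_sub_left (μ ν : DualSection I F L) (s : Cₛ^∞⟮I; F, L⟯) :
    pair (μ - ν) s = pair μ s - pair ν s := rfl

theorem pair_smul_left (f : C^∞⟮I, M; ℝ⟯) (μ : DualSection I F L) (s : Cₛ^∞⟮I; F, L⟯) :
    pair (f • μ) s = f * pair μ s := rfl

theorem pair_real_smul_left (c : ℝ) (μ : DualSection I F L) (s : Cₛ^∞⟮I; F, L⟯) :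
    pair (c • μ) s = c • pair μ s := rfl

theorem pair_sum_left {ι : Type*} (a : Finset ι) (μ : ι → DualSection I F L)
    (s : Cₛ^∞⟮I; F, L⟯) : pair (∑ i ∈ a, μ i) s = ∑ i ∈ a, pair (μ i) s :=
  map_sum (AddMonoidHom.mk' (fun μ : DualSection I F L => pair μ s)
    fun μ ν => pair_add_left μ ν s) μ a

/-- An induced bracket may be checked on smooth sections. -/
theorem isInducedBracket_iff {n : ℕ} {W : ∀ v : TotalSpace F L, MVec I n v}
    {μ : Fin n → DualSection I F L} {ν : DualSection I F L} :
    IsInducedBracket W μ ν ↔ ∀ (s : Cₛ^∞⟮I; F, L⟯) (p : M),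
      pair ν s p = W (TotalSpace.mk' F p (s p))
        (fun i => diff I (iota (μ i)) (TotalSpace.mk' F p (s p))) := by
  refine ⟨fun h s p => h (TotalSpace.mk' F p (s p)), fun h v => ?_⟩
  obtain ⟨p, w⟩ := v
  obtain ⟨s, rfl⟩ := exists_section_apply_eq (F := F) I p w
  exact h s p

/-! ### Multisections, vertical lifts and the Liouville term. -/

/-- Replacing the `k`-th argument of a multisection is, up to sign, pairing with the contraction
by the remaining arguments. -/
theorem Multisection.eval_update {n : ℕ} (X : Multisection I F L (n + 1))
    (μ : Fin (n + 1) → DualSection I F L) (k : Fin (n + 1)) (ν : DualSection I F L) :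
    X.eval (Function.update μ k ν) =
      (-1 : ℝ) ^ (n + (k : ℕ)) • pair ν (X.contract (k.removeNth μ)) := by
  rw [X.pair_contract]
  ext p
  have h := (X.toFun p).map_update_eq_snoc (fun i => μ i p) k (ν p)
  have h1 : (fun i => Function.update μ k ν i p) =
      Function.update (fun i => μ i p) k (ν p) := by
    funext i
    by_cases hi : i = k
    · subst hi; simp
    · simp [hi]
  have h2 : (fun i => (Fin.snoc (α := fun _ => DualSection I F L) (k.removeNth μ) ν :
      Fin (n + 1) → DualSection I F L) i p) =
      Fin.snoc (α := fun _ => Dual L p) (k.removeNth fun i => μ i p) (ν p) := by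
    funext i
    refine Fin.lastCases ?_ (fun j => ?_) i <;> simp [Fin.removeNth]
  show X.toFun p _ = (-1 : ℝ) ^ (n + (k : ℕ)) * X.toFun p _
  rw [h1, h, h2, zsmul_eq_mul]
  push_cast
  rfl

theorem Multisection.eval_apply {n : ℕ} (X : Multisection I F L n)
    (μ : Fin n → DualSection I F L) (p : M) : X.eval μ p = X.toFun p (fun i => μ i p) := rfl

theorem Multisection.eval_update_apply {n : ℕ} (X : Multisection I F L n)
    (μ : Fin n → DualSection I F L) (k : Fin n) (ν : DualSection I F L) (p : M) :
    X.eval (Function.update μ k ν) p =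
      X.toFun p (Function.update (fun i => μ i p) k (ν p)) := by
  rw [X.eval_apply]
  congr 1
  funext i
  by_cases hi : i = k
  · subst hi; simp
  · simp [hi]

/-- The vertical lift, evaluated on differentials of fibrewise linear functions. -/
theorem Multisection.verticalLift_diff_iota {n : ℕ} (X : Multisection I F L n)
    (v : TotalSpace F L) (μ : Fin n → DualSection I F L) :
    X.verticalLift v (fun i => diff I (iota (μ i)) v) = X.eval μ v.proj := by
  show X.toFun v.proj _ = X.toFun v.proj _
  congr 1
  funext i
  ext w
  exact diff_iota_vert (μ i) v w

theorem diff_iota_liouville (μ : DualSection I F L) (v : TotalSpace F L) :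
    diff I (iota μ) v (liouville I v) = iota μ v := diff_iota_vert μ v v.2

/-- The term `∇ ∧ (i_Φ X)^v` of the Poisson lift, evaluated on differentials of fibrewise linear
functions. -/
theorem Multisection.liouville_wedge_interior {n : ℕ} (X : Multisection I F L (n + 1))
    (Φ : DualSection I F L) (v : TotalSpace F L) (μ : Fin (n + 1) → DualSection I F L) :
    vecWedge (liouville I v) ((X.interior Φ).verticalLift v) (fun i => diff I (iota (μ i)) v) =
      ∑ k, iota (μ k) v * X.eval (Function.update μ k Φ) v.proj := by
  rw [vecWedge_apply]
  refine Finset.sum_congr rfl fun k _ => ?_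
  have h := (X.interior Φ).verticalLift_diff_iota v (k.removeNth μ)
  have h1 : (X.interior Φ).verticalLift v
      (k.removeNth fun i => diff I (iota (μ i)) v) =
      (X.interior Φ).eval (k.removeNth μ) v.proj := h
  have h2 : (X.interior Φ).eval (k.removeNth μ) v.proj =
    X.toFun v.proj (Matrix.vecCons (Φ v.proj) (k.removeNth fun i => μ i v.proj)) := rfl
  -- The sign `(-1)^k` in the exterior product is the one that moves `Φ` from the first place to the
  -- `k`-th.
  rw [h1, h2, diff_iota_liouville, X.eval_update_apply,
    (X.toFun v.proj).map_update_eq_vecCons, zsmul_eq_mul]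
  push_cast
  ring

namespace LieAlgebroid

variable (A : LieAlgebroid I F L)

/-! ### Lie derivatives of `1`-forms. -/

theorem bracket_swap (X Y : Cₛ^∞⟮I; F, L⟯) : A.bracket X Y = -A.bracket Y X := by
  have h := A.bracket_self (X + Y)
  simp only [map_add, LinearMap.add_apply, A.bracket_self, zero_add, add_zero] at h
  exact eq_neg_of_add_eq_zero_right h

theorem dForm_swap (μ : DualSection I F L) (X Y : Cₛ^∞⟮I; F, L⟯) :
    A.dForm μ X Y = -A.dForm μ Y X := by
  rw [dForm, dForm, A.bracket_swap X Y, pair_neg]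
  ring

/-- By antisymmetry, `dμ(X, s) = -dμ(s, X)`. In this form `X` is no longer differentiated: the right
side is the difference of a derivation along `s` and a `C^∞(M)`-linear term, which is what the
Leibniz rule for determinants needs. -/
theorem pair_lieDeriv_eq (X s : Cₛ^∞⟮I; F, L⟯) (μ : DualSection I F L) :
    pair (A.lieDeriv X μ) s =
      vectorFieldApply (A.anchor s) (pair μ X) - pair (A.interiorD s μ) X := by
  rw [lieDeriv, pair_add_left, pair_interiorD, pair_interiorD, pair_d, A.dForm_swap]
  ring

/-- The two multiples of `Φ`, from `i_X (Φ ∧ μ)` and from `d^Φ (i_X μ)`, cancel. -/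
theorem lieDerivPhi_eq (Φ : DualSection I F L) (X : Cₛ^∞⟮I; F, L⟯) (μ : DualSection I F L) :
    A.lieDerivPhi Φ X μ = A.lieDeriv X μ + pair Φ X • μ := by
  rw [lieDerivPhi, interiorDPhi, dPhi, lieDeriv]
  abel

theorem diff_iota_liftVec (X : Cₛ^∞⟮I; F, L⟯) (v : TotalSpace F L) (μ : DualSection I F L) :
    diff I (iota μ) v (A.liftVec X v) = iota (A.lieDeriv X μ) v :=
  (A.exists_isLiftVec X v).choose_spec.1 μ

/-! ### The complete lift on differentials of fibrewise linear functions. -/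

/-- The complete lift of an expression, evaluated on differentials of fibrewise linear functions. -/
theorem completeLiftOf_diff_iota {n : ℕ} {X : Multisection I F L n} (s : Cₛ^∞⟮I; F, L⟯) (p : M)
    (P : LocalExpression X (TotalSpace.mk' F p (s p)).proj) (μ : Fin n → DualSection I F L) :
    A.completeLiftOf P (fun i => diff I (iota (μ i)) (TotalSpace.mk' F p (s p))) =
      vectorFieldApply (A.anchor s) (X.eval μ) p -
        ∑ k, X.eval (Function.update μ k (A.interiorD s (μ k))) p := by
  let _ := P.fintype
  -- Evaluation at `p` is a ring homomorphism and so commutes with determinants; the identity can be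
  -- proved for matrices over the ring of smooth functions.
  let e : C^∞⟮I, M; ℝ⟯ →+* ℝ := ContMDiffMap.evalRingHom p
  have he : ∀ f, e f = f p := fun _ => rfl
  let N : P.ι → Matrix (Fin n) (Fin n) C^∞⟮I, M; ℝ⟯ :=
    fun a => Matrix.of fun i j => pair (μ j) (P.vec a i)
  let B : P.ι → Matrix (Fin n) (Fin n) C^∞⟮I, M; ℝ⟯ :=
    fun a => Matrix.of fun i j => pair (A.interiorD s (μ j)) (P.vec a i)
  have hsum : ∀ (q : M) (g : P.ι → Dual L q [⋀^Fin n]→ₗ[ℝ] ℝ) θ,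
      (∑ a, g a) θ = ∑ a, g a θ := fun q g θ =>
    map_sum (AddMonoidHom.mk' (fun G : Dual L q [⋀^Fin n]→ₗ[ℝ] ℝ => G θ) fun _ _ => rfl) g _
  -- Equality near `p`, not only at `p`, is needed because `X.eval μ` is differentiated in `hder`.
  have hX : ∀ ν : Fin n → DualSection I F L, ∀ᶠ q in 𝓝 p, X.eval ν q =
      (∑ a, P.coeff a * (Matrix.of fun i j => pair (ν j) (P.vec a i)).det) q := by
    intro ν
    filter_upwards [P.eventually_eq] with q hq
    rw [X.eval_apply, hq, hsum, function_sum_apply]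
    refine Finset.sum_congr rfl fun a _ => ?_
    have h := (ContMDiffMap.evalRingHom (I := I) (n := ∞) (I' := 𝓘(ℝ)) (R := ℝ) q).map_det
      (Matrix.of fun i j => pair (ν j) (P.vec a i))
    show P.coeff a q * wedge _ _ = P.coeff a q * _
    congr 1
    rw [wedge_apply]
    exact h.symm
  -- Columns are indexed by the `1`-forms and rows by the sections, so a new argument is a new
  -- column.
  have hupd : ∀ k, X.eval (Function.update μ k (A.interiorD s (μ k))) p =
      e (∑ a, P.coeff a * ((N a).updateCol k fun i => B a i k).det) := by
    intro k
    rw [(hX _).self_of_nhds]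
    refine congrArg e (Finset.sum_congr rfl fun a _ => ?_)
    congr 2
    ext i j : 1
    by_cases hj : j = k
    · subst hj; simp [B]
    · simp [N, hj]
  have hder : vectorFieldApply (A.anchor s) (X.eval μ) p =
      e (∑ a, (P.coeff a * ∑ i, ((N a).updateRow i fun j =>
          vectorFieldApply (A.anchor s) (N a i j)).det +
        (N a).det * pair (A.d (P.coeff a)) s)) := by
    rw [vectorFieldApply_apply_congr _ (hX μ), ← vectorFieldDerivation_apply, map_sum, he]
    congr 1
    refine Finset.sum_congr rfl fun a _ => ?_
    rw [Derivation.leibniz, Derivation.map_det, A.pair_d]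
    rfl
  have hrow : ∀ a i, (N a).updateRow i (fun j => vectorFieldApply (A.anchor s) (N a i j)) =
      (N a).updateRow i ((fun j => pair (A.lieDeriv (P.vec a i) (μ j)) s) + B a i) := by
    intro a i
    congr 1
    funext j
    rw [Pi.add_apply, A.pair_lieDeriv_eq]
    exact (sub_add_cancel _ _).symm
  have hmat : ∀ (x : Fin n → TVec I (TotalSpace.mk' F p (s p)))
      (C : Matrix (Fin n) (Fin n) C^∞⟮I, M; ℝ⟯),
      (∀ i j, diff I (iota (μ j)) (TotalSpace.mk' F p (s p)) (x i) = e (C i j)) →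
      wedge x (fun i => diff I (iota (μ i)) (TotalSpace.mk' F p (s p))) = e C.det := by
    intro x C h
    rw [wedge_apply, e.map_det]
    congr 1
    ext i j
    exact h i j
  have hlift : A.completeLiftOf P (fun i => diff I (iota (μ i)) (TotalSpace.mk' F p (s p))) =
      e (∑ a, (pair (A.d (P.coeff a)) s * (N a).det + P.coeff a * ∑ i, ((N a).updateRow i
        fun j => pair (A.lieDeriv (P.vec a i) (μ j)) s).det)) := by
    have hsum' : ∀ {κ : Type} [Fintype κ] (g : κ → MVec I n (TotalSpace.mk' F p (s p))) θ,
        (∑ a, g a) θ = ∑ a, g a θ := fun g θ =>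
      map_sum (AddMonoidHom.mk' (fun G : MVec I n (TotalSpace.mk' F p (s p)) => G θ)
        fun _ _ => rfl) g _
    rw [completeLiftOf, hsum', map_sum]
    refine Finset.sum_congr rfl fun a _ => ?_
    rw [AlternatingMap.add_apply, AlternatingMap.smul_apply, AlternatingMap.smul_apply, hsum',
      hmat _ (N a) fun i j => diff_iota_vert _ _ _, map_add, map_mul, map_mul, map_sum]
    congr 1
    show P.coeff a p * _ = P.coeff a p * _
    congr 1
    refine Finset.sum_congr rfl fun i _ => hmat _ _ fun i' j => ?_
    by_cases hi : i' = i
    · subst hi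
      rw [Function.update_self, Matrix.updateRow_self, A.diff_iota_liftVec]
      rfl
    · rw [Function.update_of_ne hi, Matrix.updateRow_ne hi, diff_iota_vert]
      rfl
  rw [hlift, hder, Finset.sum_congr rfl fun k _ => hupd k, ← map_sum, ← map_sub]
  congr 1
  rw [Finset.sum_comm, ← Finset.sum_sub_distrib]
  refine Finset.sum_congr rfl fun a _ => ?_
  simp only [hrow, Matrix.det_updateRow_add, Finset.sum_add_distrib]
  -- The lift has produced replaced rows `B a i`, while the arguments of `X` are columns; only the
  -- sums over all places agree.
  rw [Matrix.sum_det_updateRow_eq_sum_det_updateCol, ← Finset.mul_sum]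
  ring

/-- The right side does not involve the chosen local expression, so on these differentials the
choice made in `completeLift` is immaterial. -/
theorem completeLift_diff_iota {n : ℕ} (X : Multisection I F L n) (s : Cₛ^∞⟮I; F, L⟯) (p : M)
    (μ : Fin n → DualSection I F L) :
    A.completeLift X (TotalSpace.mk' F p (s p))
        (fun i => diff I (iota (μ i)) (TotalSpace.mk' F p (s p))) =
      vectorFieldApply (A.anchor s) (X.eval μ) p -
        ∑ k, X.eval (Function.update μ k (A.interiorD s (μ k))) p :=
  A.completeLiftOf_diff_iota s p _ μ

/-! ### The bracket formula. -/

/-- The Lie derivatives along the contractions of a multisection, in terms of its values. -/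
theorem pair_lieDeriv_contract {n : ℕ} (X : Multisection I F L (n + 1))
    (μ : Fin (n + 1) → DualSection I F L) (k : Fin (n + 1)) (s : Cₛ^∞⟮I; F, L⟯) :
    (-1 : ℝ) ^ (n + (k : ℕ)) • pair (A.lieDeriv (X.contract (k.removeNth μ)) (μ k)) s =
      vectorFieldApply (A.anchor s) (X.eval μ) -
        X.eval (Function.update μ k (A.interiorD s (μ k))) := by
  have h : X.eval μ = (-1 : ℝ) ^ (n + (k : ℕ)) • pair (μ k) (X.contract (k.removeNth μ)) := by
    rw [← X.eval_update, Function.update_eq_self]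
  rw [h, X.eval_update, A.pair_lieDeriv_eq, vectorFieldApply_smul, smul_sub]

theorem isInducedBracket_poissonLift (Φ : DualSection I F L) {n : ℕ}
    (X : Multisection I F L (n + 1)) (μ : Fin (n + 1) → DualSection I F L) :
    IsInducedBracket (A.poissonLift Φ X) μ
      (∑ k : Fin (n + 1),
          (-1 : ℝ) ^ (n + (k : ℕ)) • A.lieDerivPhi Φ (X.contract (k.removeNth μ)) (μ k) -
        (n : ℝ) • A.dPhi Φ (X.eval μ)) := by
  rw [isInducedBracket_iff]
  intro s p
  -- The sign `(-1)^(n + k)` is absorbed by `eval_update`: it puts `i_s dμ_k`, respectively `Φ`,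
  -- back into the `k`-th place of `X`.
  have hk : ∀ k : Fin (n + 1), pair ((-1 : ℝ) ^ (n + (k : ℕ)) •
      A.lieDerivPhi Φ (X.contract (k.removeNth μ)) (μ k)) s =
      vectorFieldApply (A.anchor s) (X.eval μ) -
        X.eval (Function.update μ k (A.interiorD s (μ k))) +
        pair (μ k) s * X.eval (Function.update μ k Φ) := by
    intro k
    rw [A.lieDerivPhi_eq, pair_real_smul_left, pair_add_left, smul_add, A.pair_lieDeriv_contract,
      pair_smul_left, X.eval_update μ k Φ, mul_comm, mul_smul_comm]
  have hd : pair (A.dPhi Φ (X.eval μ)) s =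
      vectorFieldApply (A.anchor s) (X.eval μ) + X.eval μ * pair Φ s := by
    rw [dPhi, pair_add_left, pair_d, pair_smul_left]
  have hl : A.poissonLift Φ X (TotalSpace.mk' F p (s p))
        (fun i => diff I (iota (μ i)) (TotalSpace.mk' F p (s p))) =
      A.completeLift X (TotalSpace.mk' F p (s p))
        (fun i => diff I (iota (μ i)) (TotalSpace.mk' F p (s p))) -
      ((n : ℝ) * iota Φ (TotalSpace.mk' F p (s p))) * X.verticalLift (TotalSpace.mk' F p (s p))
        (fun i => diff I (iota (μ i)) (TotalSpace.mk' F p (s p))) +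
      vecWedge (liouville I (TotalSpace.mk' F p (s p)))
        ((X.interior Φ).verticalLift (TotalSpace.mk' F p (s p)))
        (fun i => diff I (iota (μ i)) (TotalSpace.mk' F p (s p))) := rfl
  rw [hl, A.completeLift_diff_iota, X.verticalLift_diff_iota, X.liouville_wedge_interior,
    pair_sub_left, pair_sum_left, Finset.sum_congr rfl fun k _ => hk k, pair_real_smul_left, hd]
  simp only [Finset.sum_add_distrib, Finset.sum_sub_distrib, Finset.sum_const, Finset.card_univ,
    Fintype.card_fin]
  have hs : ∀ f : Fin (n + 1) → C^∞⟮I, M; ℝ⟯, (∑ k, f k) p = ∑ k, f k p :=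
    fun f => function_sum_apply _ f p
  have hΦ : iota Φ (TotalSpace.mk' F p (s p)) = pair Φ s p := rfl
  have hμ : ∀ k, iota (μ k) (TotalSpace.mk' F p (s p)) = pair (μ k) s p := fun _ => rfl
  simp only [hΦ, hμ, nsmul_eq_mul, ContMDiffMap.coe_sub, ContMDiffMap.coe_add, ContMDiffMap.coe_mul,
    ContMDiffMap.coe_smul, Pi.sub_apply, Pi.add_apply, Pi.mul_apply, Pi.smul_apply, hs, smul_eq_mul]
  -- The sum over `k` yields `n + 1` copies of `a(s)(X(μ))`, of which `n` cancel against `n d^Φ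
  -- X(μ)`.
  have hn : ((n + 1 : ℕ) : C^∞⟮I, M; ℝ⟯) p = (n : ℝ) + 1 := by
    have := map_natCast (ContMDiffMap.evalRingHom (I := I) (n := ∞) (I' := 𝓘(ℝ)) (R := ℝ) p) (n + 1)
    exact this.trans (by push_cast; rfl)
  rw [hn]
  ring

/-! ### Exact arguments and the case of a function. -/

/-- The anchor is compatible with the brackets, so that `d (d f) = 0`. -/
theorem dForm_d (f : C^∞⟮I, M; ℝ⟯) (X Y : Cₛ^∞⟮I; F, L⟯) : A.dForm (A.d f) X Y = 0 := by
  -- In rank zero `Y = 0`. The argument for positive rank needs a nonzero vector in the fibre.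
  rcases subsingleton_or_nontrivial F with hF | hF
  · have hY : Y = (0 : C^∞⟮I, M; ℝ⟯) • Y := by
      ext q
      exact ((trivializationAt F L q).continuousLinearEquivAt ℝ q
        (mem_baseSet_trivializationAt F L q)).injective (Subsingleton.elim _ _)
    rw [hY, dForm_smul, zero_mul]
  rw [dForm]
  simp only [pair_d]
  set g := vectorFieldApply (A.anchor X) (vectorFieldApply (A.anchor Y) f) -
    vectorFieldApply (A.anchor Y) (vectorFieldApply (A.anchor X) f) -
    vectorFieldApply (A.anchor (A.bracket X Y)) f with hg
  have h : ∀ Z : Cₛ^∞⟮I; F, L⟯, g • Z = 0 := by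
    intro Z
    -- Expanding Jacobi for `f • Z` by the Leibniz rule, the terms with only one derivative of `f`
    -- cancel and Jacobi for `Z` removes those with none; the remainder is `g • Z = 0`.
    have h1 := A.jacobi X Y (f • Z)
    simp only [A.leibniz, map_add] at h1
    rw [A.jacobi X Y Z, smul_add] at h1
    rw [hg, sub_smul, sub_smul, sub_sub, sub_eq_zero]
    rw [← sub_eq_zero] at h1 ⊢
    rw [← h1]
    abel
  ext p
  obtain ⟨y, hy⟩ := exists_ne (0 : F)
  let t := (trivializationAt F L p).continuousLinearEquivAt ℝ p
    (mem_baseSet_trivializationAt F L p)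
  obtain ⟨Z, hZ⟩ := exists_section_apply_eq (F := F) I p (t.symm y)
  have h2 : g p • Z p = 0 := congrArg (fun s : Cₛ^∞⟮I; F, L⟯ => s p) (h Z)
  rw [hZ] at h2
  exact (smul_eq_zero.1 h2).resolve_right fun h0 => hy ((map_eq_zero_iff _ t.symm.injective).1 h0)

/-- By Cartan's formula this is `d^Φ d^Φ f = 0`. Indeed `d(f Φ) = df ∧ Φ + f dΦ`, whose first term
cancels against `Φ ∧ df`, and both `d(df)` and `dΦ` vanish. -/
theorem lieDerivPhi_dPhi {Φ : DualSection I F L} (hΦ : A.IsCocycle Φ) (X : Cₛ^∞⟮I; F, L⟯)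
    (f : C^∞⟮I, M; ℝ⟯) : A.lieDerivPhi Φ X (A.dPhi Φ f) = A.dPhi Φ (pair (A.dPhi Φ f) X) := by
  have h : A.interiorDPhi Φ X (A.dPhi Φ f) = 0 := by
    refine dualSection_ext fun Y => ?_
    have h1 := A.dForm_d f X Y
    have h2 := hΦ X Y
    simp only [dForm, pair_d] at h1 h2
    have h3 : pair (0 : DualSection I F L) Y = 0 := rfl
    simp only [interiorDPhi, dPhi, pair_add_left, pair_sub_left, pair_smul_left, pair_interiorD,
      dForm, pair_d, vectorFieldApply_add, vectorFieldApply_mul, h3]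
    linear_combination h1 + f * h2
  rw [lieDerivPhi, h, zero_add]

theorem dPhi_smul (Φ : DualSection I F L) (c : ℝ) (f : C^∞⟮I, M; ℝ⟯) :
    A.dPhi Φ (c • f) = c • A.dPhi Φ f := by
  refine dualSection_ext fun Y => ?_
  simp only [dPhi, pair_real_smul_left, pair_add_left, pair_d, pair_smul_left,
    vectorFieldApply_smul, smul_add, smul_mul_assoc]

theorem isInducedBracket_poissonLift_dPhi {Φ : DualSection I F L} (hΦ : A.IsCocycle Φ) {n : ℕ}
    (X : Multisection I F L (n + 1)) (f : Fin (n + 1) → C^∞⟮I, M; ℝ⟯) :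
    IsInducedBracket (A.poissonLift Φ X) (fun i => A.dPhi Φ (f i))
      (A.dPhi Φ (X.eval fun i => A.dPhi Φ (f i))) := by
  convert A.isInducedBracket_poissonLift Φ X (fun i => A.dPhi Φ (f i)) using 1
  have hk : ∀ k : Fin (n + 1), (-1 : ℝ) ^ (n + (k : ℕ)) • A.lieDerivPhi Φ
      (X.contract (k.removeNth fun i => A.dPhi Φ (f i))) (A.dPhi Φ (f k)) =
      A.dPhi Φ (X.eval fun i => A.dPhi Φ (f i)) := by
    intro k
    have h := X.eval_update (fun i => A.dPhi Φ (f i)) k (A.dPhi Φ (f k))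
    -- The sign times `⟨d^Φ f_k, X_k⟩` is `X` with its `k`-th argument replaced by itself.
    rw [A.lieDerivPhi_dPhi hΦ, ← A.dPhi_smul, ← h, Function.update_eq_self_iff.2 rfl]
  rw [Finset.sum_congr rfl fun k _ => hk k, Finset.sum_const, Finset.card_univ, Fintype.card_fin,
    ← Nat.cast_smul_eq_nsmul ℝ, ← sub_smul]
  simp

/-- Here `-x = 1`: the complete lift contributes `ι_{dX}` and the vertical term contributes `X ι_Φ`.
-/
theorem isInducedBracket_poissonLift_function (Φ : DualSection I F L) (X : Multisection I F L 0)
    (μ : Fin 0 → DualSection I F L) :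
    IsInducedBracket (A.poissonLift Φ X) μ (A.dPhi Φ (X.eval μ)) := by
  rw [isInducedBracket_iff]
  intro s p
  have hl : A.poissonLift Φ X (TotalSpace.mk' F p (s p))
        (fun i => diff I (iota (μ i)) (TotalSpace.mk' F p (s p))) =
      A.completeLift X (TotalSpace.mk' F p (s p))
        (fun i => diff I (iota (μ i)) (TotalSpace.mk' F p (s p))) +
      iota Φ (TotalSpace.mk' F p (s p)) * X.verticalLift (TotalSpace.mk' F p (s p))
        (fun i => diff I (iota (μ i)) (TotalSpace.mk' F p (s p))) := rfl
  rw [hl, A.completeLift_diff_iota, X.verticalLift_diff_iota, Finset.univ_eq_empty,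
    Finset.sum_empty, sub_zero, dPhi, pair_add_left, pair_d, pair_smul_left, mul_comm]
  rfl

end LieAlgebroid

end JacobiAlgebroid

end

theorem theorem14 {E : Type*} [NormedAddCommGroup E] [NormedSpace ℝ E] [FiniteDimensional ℝ E]
    {H : Type*} [TopologicalSpace H] {I : ModelWithCorners ℝ E H}
    {M : Type*} [TopologicalSpace M] [ChartedSpace H M] [IsManifold I ∞ M]
    [BoundarylessManifold I M] [T2Space M]
    {F : Type*} [NormedAddCommGroup F] [NormedSpace ℝ F] [FiniteDimensional ℝ F]
    {L : M → Type*} [TopologicalSpace (TotalSpace F L)]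
    [∀ p, AddCommGroup (L p)] [∀ p, Module ℝ (L p)] [∀ p, TopologicalSpace (L p)]
    [∀ p, IsTopologicalAddGroup (L p)] [∀ p, ContinuousSMul ℝ (L p)]
    [FiberBundle F L] [VectorBundle ℝ F L] [ContMDiffVectorBundle ∞ F L I]
    (A : JacobiAlgebroid.LieAlgebroid I F L) (Φ : JacobiAlgebroid.DualSection I F L)
    (hΦ : A.IsCocycle Φ) :
    (∀ (x : ℕ) (X : JacobiAlgebroid.Multisection I F L (x + 1)),
      (∀ μ : Fin (x + 1) → JacobiAlgebroid.DualSection I F L,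
        JacobiAlgebroid.IsInducedBracket (A.poissonLift Φ X) μ
          (∑ k : Fin (x + 1),
              (-1 : ℝ) ^ (x + (k : ℕ)) • A.lieDerivPhi Φ (X.contract (k.removeNth μ)) (μ k) -
            (x : ℝ) • A.dPhi Φ (X.eval μ))) ∧
      (∀ f : Fin (x + 1) → C^∞⟮I, M; ℝ⟯,
        JacobiAlgebroid.IsInducedBracket (A.poissonLift Φ X) (fun i => A.dPhi Φ (f i))
          (A.dPhi Φ (X.eval fun i => A.dPhi Φ (f i))))) ∧
    (∀ (X : JacobiAlgebroid.Multisection I F L 0)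
      (μ : Fin 0 → JacobiAlgebroid.DualSection I F L),
      JacobiAlgebroid.IsInducedBracket (A.poissonLift Φ X) μ (A.dPhi Φ (X.eval μ))) :=
  ⟨fun _ X => ⟨A.isInducedBracket_poissonLift Φ X, A.isInducedBracket_poissonLift_dPhi hΦ X⟩,
    A.isInducedBracket_poissonLift_function Φ⟩
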